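/- Let $\mathbb{K}=\mathbb{R}$ or $\mathbb{C}$, let $n\ge 2$, and let $E_1,\dots,E_n$ be Banach spaces over $\mathbb{K}$, each of which is an $\mathcal{L}_\infty$ space; that is, for each $k$ there is $\lambda>1$ such that every finite dimensional subspace of $E_k$ is contained in a finite dimensional subspace $F\subset E_k$ admitting an isomorphism $v:F\to\ell_\infty^{\dim F}$ with $\|v\|\,\|v^{-1}\|<\lambda$. Then every continuous $n$-linear form $T:E_1\times\dots\times E_n\to\mathbb{K}$ is $2$-fully $(2;2,\dots,2)$-summing: whenever $(x^{(l)}_k)_{k=1}^\infty$ is a weakly $2$-summable sequence in $E_l$ for $l=1,\dots,n$ (i.e. $\sum_{k}|\varphi(x^{(l)}_k)|^2<\infty$ for every continuous linear functional $\varphi$ on $E_l$), one has $$\sum_{j_1,j_2=1}^\infty \bigl|T\bigl(x^{(1)}_{j_1},x^{(2)}_{j_2},x^{(3)}_{j_2},\dots,x^{(n)}_{j_2}\bigr)\bigr|^2<\infty .$$ -/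

import Mathlib

open scoped ENNReal

/-- `X` is an `ℒ_{∞,lam}` space: every finite dimensional subspace of `X` is contained in a finite
dimensional subspace `F` that admits an isomorphism `v` onto `ℓ_∞^{dim F}` (that is,
`Fin (dim F) → 𝕜`, which carries the sup norm) with `‖v‖ * ‖v⁻¹‖ < lam`. -/
def IsScriptLInftyWith (𝕜 : Type*) [RCLike 𝕜] (lam : ℝ)
    (X : Type*) [NormedAddCommGroup X] [NormedSpace 𝕜 X] : Prop :=
  ∀ E : Submodule 𝕜 X, FiniteDimensional 𝕜 E →
    ∃ F : Submodule 𝕜 X, E ≤ F ∧ FiniteDimensional 𝕜 F ∧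
      ∃ v : F ≃L[𝕜] (Fin (Module.finrank 𝕜 F) → 𝕜),
        ‖(v : F →L[𝕜] (Fin (Module.finrank 𝕜 F) → 𝕜))‖ *
          ‖(v.symm : (Fin (Module.finrank 𝕜 F) → 𝕜) →L[𝕜] F)‖ < lam

/-- `X` is an `ℒ_∞` space: it is an `ℒ_{∞,lam}` space for some `lam > 1`. -/
def IsScriptLInfty (𝕜 : Type*) [RCLike 𝕜]
    (X : Type*) [NormedAddCommGroup X] [NormedSpace 𝕜 X] : Prop :=
  ∃ lam : ℝ, 1 < lam ∧ IsScriptLInftyWith 𝕜 lam X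

/-- Membership of the sequence `x` in `ℓ_q^w(E)`: for every continuous linear functional `φ`
on `E`, the scalar sequence `(φ (x j))_j` lies in `ℓ_q`. -/
def IsWeaklySummable (𝕜 : Type*) [RCLike 𝕜] {E : Type*} [NormedAddCommGroup E] [NormedSpace 𝕜 E]
    (q : ℝ≥0∞) (x : ℕ → E) : Prop :=
  ∀ φ : E →L[𝕜] 𝕜, Memℓp (fun j : ℕ => φ (x j)) q

/-- The continuous `n`-linear mapping `T` is `r`-fully `(p; q₁, …, qₙ)`-summing (`1 ≤ r ≤ n`):
whenever `(x l k)_k ∈ ℓ_{q l}^w(E l)` for all `l`, the multiple series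
`∑_{j₁, …, j_r} ‖T (x₁ j₁, …, x_r j_r, x_{r+1} j_r, …, x_n j_r)‖ ^ p` converges.
Indices start at `0`: slot `l` uses the summation index number `min l (r - 1)`. -/
def IsFullySumming {𝕜 : Type*} [RCLike 𝕜] {n : ℕ} {E : Fin n → Type*}
    [∀ l, NormedAddCommGroup (E l)] [∀ l, NormedSpace 𝕜 (E l)]
    {F : Type*} [NormedAddCommGroup F] [NormedSpace 𝕜 F]
    (r : ℕ) [NeZero r] (p : ℝ) (q : Fin n → ℝ≥0∞)
    (T : ContinuousMultilinearMap 𝕜 E F) : Prop :=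
  ∀ x : (l : Fin n) → ℕ → E l, (∀ l, IsWeaklySummable 𝕜 (q l) (x l)) →
    Summable fun j : Fin r → ℕ =>
      ‖T fun l => x l (j ⟨min (l : ℕ) (r - 1), by have := NeZero.pos r; omega⟩)‖ ^ p

/-! A stronger statement holds: the full `n`-fold sum of `|T (x₁ j₁, …, xₙ jₙ)|²` is finite, and the
double series is a subsum of it. Hahn–Banach and the `ℒ_∞` structure reduce this to forms on finite
dimensional `ℓ_∞` spaces, where a constant independent of the dimensions is needed
(`isHilbertSchmidtBound_of_norm_le`).

That constant comes from self-improvement. Replacing each family by its normalized Rademacher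
averages leaves the square sum unchanged. Truncating the averages at height `M` gives a bounded
part, controlled by the norm of `T`, and a tail which by the fourth moment has squared weak `ℓ₂`
norm at most `3 / M²`. If `c` is the optimal constant, every term containing a tail costs at most `c
* (3 / M²)`, so for large `M` these terms are absorbed into `c`. -/

section Rademacher

/-! ### Second and fourth moments of Rademacher sums. -/

variable {𝕜 : Type*} [RCLike 𝕜] {ι : Type*}

/-- The Rademacher function with index `k` on the group of signs `ι → ℤˣ`. -/
def rademacher (𝕜 : Type*) [RCLike 𝕜] {ι : Type*} (ω : ι → ℤˣ) (k : ι) : 𝕜 := ((ω k : ℤ) : 𝕜)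

lemma rademacher_mul_self (ω : ι → ℤˣ) (k : ι) : rademacher 𝕜 ω k * rademacher 𝕜 ω k = 1 := by
  rcases Int.units_eq_one_or (ω k) with h | h <;> simp [rademacher, h]

lemma norm_rademacher (ω : ι → ℤˣ) (k : ι) : ‖rademacher 𝕜 ω k‖ = 1 := by
  rcases Int.units_eq_one_or (ω k) with h | h <;> simp [rademacher, h]

lemma star_rademacher (ω : ι → ℤˣ) (k : ι) :
    star (rademacher 𝕜 ω k) = rademacher 𝕜 ω k := by
  rcases Int.units_eq_one_or (ω k) with h | h <;> simp [rademacher, h]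

lemma norm_add_sq_add_norm_sub_sq (u v : 𝕜) :
    ‖u + v‖ ^ 2 + ‖u - v‖ ^ 2 = 2 * (‖u‖ ^ 2 + ‖v‖ ^ 2) := by
  have := parallelogram_law_with_norm 𝕜 u v
  nlinarith [this]

/-- The parallelogram law fixes the sum of the two squares `p` and `q`, and each is at most `(‖u‖ +
‖v‖)²`. Expanding the product of the two nonnegative gaps bounds `p² + q²`. -/
lemma norm_add_pow_four_add_norm_sub_pow_four_le (u v : 𝕜) :
    ‖u + v‖ ^ 4 + ‖u - v‖ ^ 4 ≤ 2 * (‖u‖ ^ 4 + 6 * ‖u‖ ^ 2 * ‖v‖ ^ 2 + ‖v‖ ^ 4) := by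
  have h := norm_add_sq_add_norm_sub_sq u v
  have h1 : ‖u + v‖ ≤ ‖u‖ + ‖v‖ := norm_add_le u v
  have h2 : ‖u - v‖ ≤ ‖u‖ + ‖v‖ := norm_sub_le u v
  have h3 : ‖u + v‖ ^ 2 ≤ (‖u‖ + ‖v‖) ^ 2 := by gcongr
  have h4 : ‖u - v‖ ^ 2 ≤ (‖u‖ + ‖v‖) ^ 2 := by gcongr
  set p := ‖u + v‖ ^ 2
  set q := ‖u - v‖ ^ 2
  have hp : ‖u + v‖ ^ 4 = p ^ 2 := by simp only [p]; ring
  have hq : ‖u - v‖ ^ 4 = q ^ 2 := by simp only [q]; ring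
  rw [hp, hq]
  have hq' : q = 2 * (‖u‖ ^ 2 + ‖v‖ ^ 2) - p := by linarith
  rw [hq'] at h4 ⊢
  nlinarith [mul_nonneg (sub_nonneg.2 h3) (sub_nonneg.2 h4)]

variable [DecidableEq ι]

lemma rademacher_mul_mulSingle_self (ω : ι → ℤˣ) (a : ι) :
    rademacher 𝕜 (ω * Pi.mulSingle a (-1)) a = -rademacher 𝕜 ω a := by
  simp [rademacher]

lemma rademacher_mul_mulSingle_of_ne (ω : ι → ℤˣ) {a k : ι} (h : k ≠ a) :
    rademacher 𝕜 (ω * Pi.mulSingle a (-1)) k = rademacher 𝕜 ω k := by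
  simp [rademacher, Pi.mulSingle_eq_of_ne h]

lemma sum_rademacher_mul_mulSingle_of_notMem (c : ι → 𝕜) {s : Finset ι} {a : ι} (ha : a ∉ s)
    (ω : ι → ℤˣ) :
    ∑ k ∈ s, rademacher 𝕜 (ω * Pi.mulSingle a (-1)) k * c k =
      ∑ k ∈ s, rademacher 𝕜 ω k * c k :=
  Finset.sum_congr rfl fun k hk => by
    rw [rademacher_mul_mulSingle_of_ne _ (ne_of_mem_of_not_mem hk ha)]

variable [Fintype ι]

/-- Pairing each sign vector with its flip at `a` plays the role of independence in the moment
computations. -/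
lemma two_mul_sum_signs {R : Type*} [CommSemiring R] (a : ι) (f : (ι → ℤˣ) → R) :
    2 * ∑ ω, f ω = ∑ ω, (f ω + f (ω * Pi.mulSingle a (-1))) := by
  rw [Finset.sum_add_distrib, two_mul]
  congr 1
  exact (Equiv.sum_comp (Equiv.mulRight (Pi.mulSingle a (-1 : ℤˣ))) f).symm

lemma sum_rademacher_mul (i j : ι) :
    ∑ ω : ι → ℤˣ, rademacher 𝕜 ω i * rademacher 𝕜 ω j =
      if i = j then (Fintype.card (ι → ℤˣ) : 𝕜) else 0 := by
  split_ifs with h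
  · subst h
    simp [rademacher_mul_self]
  · have h2 := two_mul_sum_signs j fun ω => rademacher 𝕜 ω i * rademacher 𝕜 ω j
    simp only [rademacher_mul_mulSingle_self, rademacher_mul_mulSingle_of_ne _ h, mul_neg,
      add_neg_cancel, Finset.sum_const_zero] at h2
    simpa using h2

lemma sum_norm_sq_rademacher_sum (c : ι → 𝕜) (s : Finset ι) :
    ∑ ω : ι → ℤˣ, ‖∑ k ∈ s, rademacher 𝕜 ω k * c k‖ ^ 2 =
      Fintype.card (ι → ℤˣ) * ∑ k ∈ s, ‖c k‖ ^ 2 := by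
  induction s using Finset.induction_on with
  | empty => simp
  | insert a s ha ih =>
    have h := two_mul_sum_signs a fun ω => ‖∑ k ∈ insert a s, rademacher 𝕜 ω k * c k‖ ^ 2
    have key : ∀ ω : ι → ℤˣ, ‖∑ k ∈ insert a s, rademacher 𝕜 ω k * c k‖ ^ 2 +
        ‖∑ k ∈ insert a s, rademacher 𝕜 (ω * Pi.mulSingle a (-1)) k * c k‖ ^ 2 =
        2 * (‖∑ k ∈ s, rademacher 𝕜 ω k * c k‖ ^ 2 + ‖c a‖ ^ 2) := by
      intro ω
      rw [Finset.sum_insert ha, Finset.sum_insert ha,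
        sum_rademacher_mul_mulSingle_of_notMem c ha, rademacher_mul_mulSingle_self, add_comm,
        add_comm (_ * _), add_comm (_ * _), neg_mul, ← sub_eq_add_neg,
        add_comm (‖_ - _‖ ^ 2), norm_add_sq_add_norm_sub_sq, norm_mul, norm_rademacher, one_mul]
    simp only [key] at h
    rw [← Finset.mul_sum, Finset.sum_add_distrib, ih, Finset.sum_const, Finset.card_univ,
      nsmul_eq_mul] at h
    rw [Finset.sum_insert ha]
    linarith

/-- Khintchine's inequality for exponent 4. The constant 3 makes the cross term `6 * ‖c a‖² * ∑ ‖c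
k‖²` of the induction step match the expanded square. -/
lemma sum_norm_pow_four_rademacher_sum_le (c : ι → 𝕜) (s : Finset ι) :
    ∑ ω : ι → ℤˣ, ‖∑ k ∈ s, rademacher 𝕜 ω k * c k‖ ^ 4 ≤
      Fintype.card (ι → ℤˣ) * (3 * (∑ k ∈ s, ‖c k‖ ^ 2) ^ 2) := by
  induction s using Finset.induction_on with
  | empty => simp
  | insert a s ha ih =>
    have h := two_mul_sum_signs a fun ω => ‖∑ k ∈ insert a s, rademacher 𝕜 ω k * c k‖ ^ 4
    have key : ∀ ω : ι → ℤˣ, ‖∑ k ∈ insert a s, rademacher 𝕜 ω k * c k‖ ^ 4 +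
        ‖∑ k ∈ insert a s, rademacher 𝕜 (ω * Pi.mulSingle a (-1)) k * c k‖ ^ 4 ≤
        2 * (‖∑ k ∈ s, rademacher 𝕜 ω k * c k‖ ^ 4 +
          6 * ‖c a‖ ^ 2 * ‖∑ k ∈ s, rademacher 𝕜 ω k * c k‖ ^ 2 + ‖c a‖ ^ 4) := by
      intro ω
      rw [Finset.sum_insert ha, Finset.sum_insert ha,
        sum_rademacher_mul_mulSingle_of_notMem c ha, rademacher_mul_mulSingle_self, add_comm,
        add_comm (_ * _), add_comm (_ * _), neg_mul, ← sub_eq_add_neg, add_comm (‖_ - _‖ ^ 4)]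
      refine (norm_add_pow_four_add_norm_sub_pow_four_le _ _).trans (le_of_eq ?_)
      rw [norm_mul, norm_rademacher, one_mul]
      ring
    have h' := h.le.trans (Finset.sum_le_sum fun ω _ => key ω)
    rw [← Finset.mul_sum, Finset.sum_add_distrib, Finset.sum_add_distrib, ← Finset.mul_sum,
      sum_norm_sq_rademacher_sum, Finset.sum_const, Finset.card_univ, nsmul_eq_mul] at h'
    rw [Finset.sum_insert ha]
    have hN : (0 : ℝ) ≤ Fintype.card (ι → ℤˣ) * ‖c a‖ ^ 4 := by positivity
    nlinarith [h', ih, hN]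

end Rademacher

/-! ### Tensor products of isometries preserve the Hilbert–Schmidt norm. -/

section Isometry

variable {𝕜 : Type*} [RCLike 𝕜] {n : ℕ}

lemma sum_norm_sq_tensor_isometry {ι Ω : Fin n → Type*} [∀ l, Fintype (ι l)]
    [∀ l, Fintype (Ω l)] [∀ l, DecidableEq (ι l)] (V : ∀ l, Ω l → ι l → 𝕜)
    (hV : ∀ l i j, ∑ ω, V l ω i * star (V l ω j) = if i = j then 1 else 0)
    (f : (∀ l, ι l) → 𝕜) :
    ∑ ω : ∀ l, Ω l, ‖∑ j : ∀ l, ι l, (∏ l, V l (ω l) (j l)) * f j‖ ^ 2 = ∑ j, ‖f j‖ ^ 2 := by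
  have hsq : ∀ z : 𝕜, ((‖z‖ ^ 2 : ℝ) : 𝕜) = z * star z := fun z => by
    rw [RCLike.star_def, RCLike.mul_conj]; push_cast; rfl
  have hdelta : ∀ i j : ∀ l, ι l, ∑ ω : ∀ l, Ω l,
      (∏ l, V l (ω l) (i l)) * star (∏ l, V l (ω l) (j l)) = if i = j then 1 else 0 := by
    intro i j
    simp only [star_prod, ← Finset.prod_mul_distrib]
    rw [← Fintype.prod_sum fun l ω => V l ω (i l) * star (V l ω (j l))]
    simp only [hV, Finset.prod_ite_zero, Finset.prod_const_one, Finset.mem_univ, true_imp_iff,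
      funext_iff]
  refine RCLike.ofReal_injective (K := 𝕜) ?_
  simp only [RCLike.ofReal_sum, hsq, star_sum, Finset.sum_mul_sum]
  rw [Finset.sum_comm]
  refine Finset.sum_congr rfl fun i _ => ?_
  rw [Finset.sum_comm]
  have : ∀ j : ∀ l, ι l, ∑ ω : ∀ l, Ω l, (∏ l, V l (ω l) (i l)) * f i *
      star ((∏ l, V l (ω l) (j l)) * f j) = (if i = j then 1 else 0) * (f i * star (f j)) := by
    intro j
    rw [← hdelta, Finset.sum_mul]
    refine Finset.sum_congr rfl fun ω _ => ?_
    rw [star_mul]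
    ring
  simp only [this]
  simp

end Isometry

/-! ### Truncation of Rademacher averages. -/

section Truncation

variable {𝕜 : Type*} [RCLike 𝕜]

/-- The Rademacher average of a family in `ℓ_∞(κ)` with weak `ℓ₂` norm at most `1` splits into a
uniformly bounded part and a part with small weak `ℓ₂` norm. -/
lemma exists_isometry_truncation {ι κ : Type} [Fintype ι] [DecidableEq ι] [Fintype κ]
    (x : ι → κ → 𝕜) (hx : ∀ t, ∑ k, ‖x k t‖ ^ 2 ≤ 1) {M : ℝ} (hM : 0 < M) :
    ∃ (V : (ι → ℤˣ) → ι → 𝕜) (b τ : (ι → ℤˣ) → κ → 𝕜),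
      (∀ i j, ∑ ω, V ω i * star (V ω j) = if i = j then 1 else 0) ∧
      (∀ ω, ∑ k, V ω k • x k = b ω + τ ω) ∧
      (∀ ω, ‖b ω‖ ^ 2 ≤ M ^ 2 / Fintype.card (ι → ℤˣ)) ∧
      (∀ t, ∑ ω, ‖b ω t‖ ^ 2 ≤ 1) ∧
      (∀ t, ∑ ω, ‖τ ω t‖ ^ 2 ≤ 3 / M ^ 2) := by
  classical
  set N : ℝ := (Fintype.card (ι → ℤˣ) : ℝ) with hN
  have hN0 : 0 < N := by rw [hN]; exact_mod_cast Fintype.card_pos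
  set g : (ι → ℤˣ) → κ → 𝕜 := fun ω t => ∑ k, rademacher 𝕜 ω k * x k t with hg
  have hs0 : (0 : ℝ) < √N := Real.sqrt_pos.2 hN0
  have hss : √N * √N = N := Real.mul_self_sqrt hN0.le
  -- The factor `N^(-1/2)` makes the columns of the Rademacher matrix orthonormal.
  set a : 𝕜 := (((√N)⁻¹ : ℝ) : 𝕜) with ha
  have han : ‖a‖ ^ 2 = N⁻¹ := by
    rw [ha, RCLike.norm_ofReal, sq_abs, inv_pow, sq, hss]
  have haa : a * star a * (N : 𝕜) = 1 := by
    rw [RCLike.star_def, RCLike.mul_conj, ← RCLike.ofReal_pow, han, ← RCLike.ofReal_mul,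
      inv_mul_cancel₀ hN0.ne', RCLike.ofReal_one]
  have hg2 : ∀ t, ∑ ω, ‖g ω t‖ ^ 2 ≤ N := fun t => by
    rw [hg, sum_norm_sq_rademacher_sum]
    exact mul_le_of_le_one_right hN0.le (hx t)
  have hg4 : ∀ t, ∑ ω, ‖g ω t‖ ^ 4 ≤ N * 3 := fun t => by
    refine (sum_norm_pow_four_rademacher_sum_le _ _).trans ?_
    have h0 : 0 ≤ ∑ k, ‖x k t‖ ^ 2 := Finset.sum_nonneg fun _ _ => by positivity
    have h1 := pow_le_one₀ (n := 2) h0 (hx t)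
    rw [← hN]
    nlinarith
  -- The truncation is made separately in each coordinate `t`. Where `‖g‖ > M`, `‖g‖² ≤ ‖g‖⁴ / M²`,
  -- so the fourth moment controls the tail.
  refine ⟨fun ω k => a * rademacher 𝕜 ω k, fun ω t => if ‖g ω t‖ ≤ M then a * g ω t else 0,
    fun ω t => if ‖g ω t‖ ≤ M then 0 else a * g ω t, ?_, ?_, ?_, ?_, ?_⟩
  · intro i j
    have : ∀ ω : ι → ℤˣ, a * rademacher 𝕜 ω i * star (a * rademacher 𝕜 ω j) =
        a * star a * (rademacher 𝕜 ω i * rademacher 𝕜 ω j) := fun ω => by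
      rw [star_mul, star_rademacher]; ring
    simp only [this]
    rw [← Finset.mul_sum, sum_rademacher_mul]
    split_ifs
    · rw [← haa, hN, RCLike.ofReal_natCast]
    · simp
  · intro ω
    ext t
    have : (∑ k, (a * rademacher 𝕜 ω k) • x k) t = a * g ω t := by
      simp [hg, Finset.sum_apply, Finset.mul_sum, mul_assoc]
    rw [this, Pi.add_apply]
    dsimp only
    split_ifs <;> simp
  · intro ω
    have hb : ‖fun t => if ‖g ω t‖ ≤ M then a * g ω t else 0‖ ≤ ‖a‖ * M := by
      refine (pi_norm_le_iff_of_nonneg (by positivity)).2 fun t => ?_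
      split_ifs with h
      · rw [norm_mul]; gcongr
      · rw [norm_zero]; positivity
    calc _ ≤ (‖a‖ * M) ^ 2 := by gcongr
      _ = M ^ 2 / N := by rw [mul_pow, han]; ring
  · intro t
    calc _ ≤ ∑ ω, N⁻¹ * ‖g ω t‖ ^ 2 := by
          refine Finset.sum_le_sum fun ω _ => ?_
          dsimp only
          split_ifs
          · rw [norm_mul, mul_pow, han]
          · rw [norm_zero, zero_pow two_ne_zero]; positivity
      _ ≤ N⁻¹ * N := by rw [← Finset.mul_sum]; gcongr; exact hg2 t
      _ = 1 := inv_mul_cancel₀ hN0.ne'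
  · intro t
    calc _ ≤ ∑ ω, N⁻¹ / M ^ 2 * ‖g ω t‖ ^ 4 := by
          refine Finset.sum_le_sum fun ω _ => ?_
          dsimp only
          split_ifs with h
          · rw [norm_zero, zero_pow two_ne_zero]; positivity
          · rw [norm_mul, mul_pow, han, div_mul_eq_mul_div, mul_div_assoc]
            gcongr
            rw [le_div_iff₀ (by positivity)]
            have : M ^ 2 ≤ ‖g ω t‖ ^ 2 := by gcongr; exact (not_le.1 h).le
            nlinarith [sq_nonneg ‖g ω t‖]
      _ ≤ N⁻¹ / M ^ 2 * (N * 3) := by rw [← Finset.mul_sum]; gcongr; exact hg4 t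
      _ = 3 / M ^ 2 := by field_simp

end Truncation

/-! ### Dimension-free bound for forms on finite dimensional `ℓ_∞` spaces. -/

section FiniteSupNorm

variable {𝕜 : Type*} [RCLike 𝕜] {n : ℕ} {κ : Fin n → Type}

/-- `C` bounds the squared Hilbert–Schmidt norm of `T` over all tuples of finite families in
`ℓ_∞(κ l)` with weak `ℓ₂` norm at most `1`. -/
def IsHilbertSchmidtBound (T : MultilinearMap 𝕜 (fun l : Fin n => κ l → 𝕜) 𝕜) (C : ℝ) : Prop :=
  ∀ (ι : Fin n → Type) [∀ l, Fintype (ι l)] (x : ∀ l, ι l → κ l → 𝕜),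
    (∀ l t, ∑ k, ‖x l k t‖ ^ 2 ≤ 1) → ∑ j : ∀ l, ι l, ‖T fun l => x l (j l)‖ ^ 2 ≤ C

lemma IsHilbertSchmidtBound.sum_le_mul_prod {T : MultilinearMap 𝕜 (fun l : Fin n => κ l → 𝕜) 𝕜}
    {C : ℝ} (hC : IsHilbertSchmidtBound T C) (ι : Fin n → Type) [∀ l, Fintype (ι l)]
    (x : ∀ l, ι l → κ l → 𝕜) (w : Fin n → ℝ) (hw : ∀ l, 0 ≤ w l)
    (hx : ∀ l t, ∑ k, ‖x l k t‖ ^ 2 ≤ w l) :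
    ∑ j : ∀ l, ι l, ‖T fun l => x l (j l)‖ ^ 2 ≤ C * ∏ l, w l := by
  set c : Fin n → 𝕜 := fun l => ((√(w l) : ℝ) : 𝕜)
  have hc : ∀ l, ‖c l‖ ^ 2 = w l := fun l => by
    simp only [c, RCLike.norm_ofReal, sq_abs, Real.sq_sqrt (hw l)]
  have hxy : ∀ l k, x l k = c l • (c l)⁻¹ • x l k := fun l k => by
    rcases eq_or_ne (c l) 0 with h | h
    · have hw0 : w l = 0 := by rw [← hc l, h]; simp
      rw [h, zero_smul]
      ext t
      have h1 := (Finset.single_le_sum (f := fun k => ‖x l k t‖ ^ 2)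
        (fun _ _ => by positivity) (Finset.mem_univ k)).trans (hx l t)
      rw [hw0] at h1
      simpa using pow_eq_zero_iff two_ne_zero |>.1 (le_antisymm h1 (by positivity))
    · rw [smul_inv_smul₀ h]
  have key := hC ι (fun l k => (c l)⁻¹ • x l k) fun l t => by
    simp only [Pi.smul_apply, smul_eq_mul, norm_mul, mul_pow, norm_inv, inv_pow, hc]
    rw [← Finset.mul_sum]
    exact (mul_le_mul_of_nonneg_left (hx l t) (inv_nonneg.2 (hw l))).trans inv_mul_le_one
  calc _ = ∑ j : ∀ l, ι l, ‖T fun l => c l • (c l)⁻¹ • x l (j l)‖ ^ 2 := by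
        simp only [← hxy]
    _ = (∑ j : ∀ l, ι l, ‖T fun l => (c l)⁻¹ • x l (j l)‖ ^ 2) * ∏ l, w l := by
        rw [Finset.sum_mul]
        refine Finset.sum_congr rfl fun j _ => ?_
        rw [T.map_smul_univ c fun l => (c l)⁻¹ • x l (j l), norm_smul, mul_pow, norm_prod,
          ← Finset.prod_pow, mul_comm]
        simp only [hc]
    _ ≤ _ := mul_le_mul_of_nonneg_right key (Finset.prod_nonneg fun l _ => hw l)

variable [∀ l, Fintype (κ l)]

/-- This crude bound depends on the dimensions. It only serves to make the optimal constant finite,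
without which nothing can be absorbed. -/
lemma exists_isHilbertSchmidtBound (T : MultilinearMap 𝕜 (fun l : Fin n => κ l → 𝕜) 𝕜) :
    ∃ C, 0 ≤ C ∧ IsHilbertSchmidtBound T C := by
  classical
  set a : (∀ l, κ l) → 𝕜 := fun t => T fun l => Pi.single (t l) 1
  refine ⟨Fintype.card (∀ l, κ l) * ∑ t, ‖a t‖ ^ 2, by positivity, fun ι _ x hx => ?_⟩
  have hT : ∀ y : ∀ l, κ l → 𝕜, T y = ∑ t : ∀ l, κ l, (∏ l, y l (t l)) * a t := by
    intro y
    have : y = fun l => ∑ t : κ l, y l t • (Pi.single t 1 : κ l → 𝕜) := by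
      funext l
      exact pi_eq_sum_univ' (y l)
    conv_lhs => rw [this, MultilinearMap.map_sum]
    refine Finset.sum_congr rfl fun t _ => ?_
    rw [MultilinearMap.map_smul_univ, smul_eq_mul]
  calc _ ≤ ∑ j : ∀ l, ι l, Fintype.card (∀ l, κ l) *
        ∑ t : ∀ l, κ l, (∏ l, ‖x l (j l) (t l)‖ ^ 2) * ‖a t‖ ^ 2 := by
        refine Finset.sum_le_sum fun j _ => ?_
        rw [hT]
        refine (pow_le_pow_left₀ (norm_nonneg _) (norm_sum_le _ _) 2).trans ?_
        refine sq_sum_le_card_mul_sum_sq.trans (le_of_eq ?_)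
        simp only [Finset.card_univ, norm_mul, norm_prod, mul_pow, Finset.prod_pow]
    _ = Fintype.card (∀ l, κ l) * ∑ t : ∀ l, κ l,
          (∏ l, ∑ k, ‖x l k (t l)‖ ^ 2) * ‖a t‖ ^ 2 := by
        rw [← Finset.mul_sum, Finset.sum_comm]
        congr 1
        refine Finset.sum_congr rfl fun t _ => ?_
        rw [← Finset.sum_mul, Fintype.prod_sum]
    _ ≤ _ := by
        gcongr with t
        refine mul_le_of_le_one_left (by positivity) ?_
        exact Finset.prod_le_one (fun l _ => Finset.sum_nonneg fun _ _ => by positivity)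
          fun l _ => hx l _

/-- One round of self-improvement: `T (b + τ)` expands into `2 ^ n` terms. The all-`b` term uses the
norm bound `A`; every other term contains some `τ` and uses `C` again, gaining `3 / M²`. One factor
`2 ^ n` comes from Cauchy–Schwarz, the other counts the terms. -/
lemma IsHilbertSchmidtBound.of_truncation {T : MultilinearMap 𝕜 (fun l : Fin n => κ l → 𝕜) 𝕜}
    {A C M : ℝ} (hM : 0 < M) (hM3 : 3 / M ^ 2 ≤ 1) (hC0 : 0 ≤ C)
    (hA : ∀ y, ‖T y‖ ≤ A * ∏ l, ‖y l‖) (hC : IsHilbertSchmidtBound T C) :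
    IsHilbertSchmidtBound T (2 ^ n * (A ^ 2 * (M ^ 2) ^ n + 2 ^ n * (C * (3 / M ^ 2)))) := by
  classical
  intro ι _ x hx
  choose V b τ hV hsum hb hb1 hτ using fun l => exists_isometry_truncation (x l) (hx l) hM
  have hiso : ∑ j : ∀ l, ι l, ‖T fun l => x l (j l)‖ ^ 2 =
      ∑ ω : ∀ l, ι l → ℤˣ, ‖T fun l => b l (ω l) + τ l (ω l)‖ ^ 2 := by
    rw [← sum_norm_sq_tensor_isometry V hV]
    refine Finset.sum_congr rfl fun ω _ => ?_
    simp only [← hsum]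
    rw [MultilinearMap.map_sum]
    simp only [T.map_smul_univ, smul_eq_mul]
  have hmain : ∑ ω : ∀ l, ι l → ℤˣ, ‖T fun l => b l (ω l)‖ ^ 2 ≤ A ^ 2 * (M ^ 2) ^ n := by
    calc _ ≤ ∑ ω : ∀ l, ι l → ℤˣ, A ^ 2 * ∏ l, (M ^ 2 / Fintype.card (ι l → ℤˣ)) := by
          refine Finset.sum_le_sum fun ω _ => ?_
          refine (pow_le_pow_left₀ (norm_nonneg _) (hA _) 2).trans ?_
          rw [mul_pow, ← Finset.prod_pow]
          gcongr with l
          exact hb l (ω l)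
      _ = A ^ 2 * ∏ l, ∑ _ω : ι l → ℤˣ, (M ^ 2 / Fintype.card (ι l → ℤˣ)) := by
          rw [← Finset.mul_sum, Fintype.prod_sum]
      _ = A ^ 2 * (M ^ 2) ^ n := by
          congr 1
          rw [Finset.prod_congr rfl fun l _ => ?_, Finset.prod_const, Finset.card_univ,
            Fintype.card_fin]
          rw [Finset.sum_const, Finset.card_univ, nsmul_eq_mul, mul_div_cancel₀]
          exact_mod_cast Fintype.card_ne_zero
  have htail : ∀ s : Finset (Fin n), s ≠ Finset.univ →
      ∑ ω : ∀ l, ι l → ℤˣ, ‖T (s.piecewise (fun l => b l (ω l)) fun l => τ l (ω l))‖ ^ 2 ≤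
        C * (3 / M ^ 2) := by
    intro s hs
    obtain ⟨i, hi⟩ : ∃ i, i ∉ s := by
      by_contra! h
      exact hs (Finset.eq_univ_iff_forall.2 h)
    have h := hC.sum_le_mul_prod (fun l => ι l → ℤˣ)
      (fun l ω => if l ∈ s then b l ω else τ l ω) (fun l => if l ∈ s then 1 else 3 / M ^ 2)
      (fun l => by split_ifs <;> positivity)
      (fun l t => by
        split_ifs
        · exact hb1 l t
        · exact hτ l t)
    have e : ∀ ω : ∀ l, ι l → ℤˣ,
        (s.piecewise (fun l => b l (ω l)) fun l => τ l (ω l)) =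
          fun l => if l ∈ s then b l (ω l) else τ l (ω l) := fun ω => rfl
    simp only [e]
    refine h.trans (mul_le_mul_of_nonneg_left ?_ hC0)
    -- One tail slot `i` supplies the gain; the remaining weights are at most 1.
    rw [← Finset.mul_prod_erase _ _ (Finset.mem_univ i), if_neg hi]
    refine mul_le_of_le_one_right (by positivity) (Finset.prod_le_one (fun l _ => ?_) fun l _ => ?_)
    · split_ifs <;> positivity
    · split_ifs
      · exact le_rfl
      · exact hM3
  rw [hiso]
  calc _ ≤ ∑ ω : ∀ l, ι l → ℤˣ, 2 ^ n * ∑ s : Finset (Fin n),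
          ‖T (s.piecewise (fun l => b l (ω l)) fun l => τ l (ω l))‖ ^ 2 := by
        refine Finset.sum_le_sum fun ω _ => ?_
        have := T.map_add_univ (fun l => b l (ω l)) fun l => τ l (ω l)
        rw [show (fun l => b l (ω l) + τ l (ω l)) =
          (fun l => b l (ω l)) + fun l => τ l (ω l) from rfl, this]
        refine (pow_le_pow_left₀ (norm_nonneg _) (norm_sum_le _ _) 2).trans ?_
        refine sq_sum_le_card_mul_sum_sq.trans (le_of_eq ?_)
        simp
    _ = 2 ^ n * ∑ s : Finset (Fin n), ∑ ω : ∀ l, ι l → ℤˣ,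
          ‖T (s.piecewise (fun l => b l (ω l)) fun l => τ l (ω l))‖ ^ 2 := by
        rw [← Finset.mul_sum, Finset.sum_comm]
    _ ≤ _ := by
        gcongr
        rw [← Finset.add_sum_erase _ _ (Finset.mem_univ (Finset.univ : Finset (Fin n)))]
        refine add_le_add (by simpa using hmain) ?_
        refine (Finset.sum_le_card_nsmul _ _ _ fun s hs =>
          htail s (Finset.ne_of_mem_erase hs)).trans ?_
        rw [nsmul_eq_mul]
        gcongr
        have : (Finset.univ.erase (Finset.univ : Finset (Fin n))).card ≤ 2 ^ n := by
          refine (Finset.card_erase_le).trans (by simp)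
        exact_mod_cast this

/-- A multilinear form of norm at most `A` on a product of finite dimensional `ℓ_∞` spaces is
multiple `2`-summing, with a constant depending only on `A` and the number of factors. -/
theorem isHilbertSchmidtBound_of_norm_le {T : MultilinearMap 𝕜 (fun l : Fin n => κ l → 𝕜) 𝕜}
    {A : ℝ} (hA : ∀ y, ‖T y‖ ≤ A * ∏ l, ‖y l‖) :
    IsHilbertSchmidtBound T (2 * (2 ^ n * (6 * 4 ^ n) ^ n) * A ^ 2) := by
  -- Chosen so that `4 ^ n * (3 / M ^ 2) = 1 / 2`.
  set M : ℝ := √(6 * 4 ^ n) with hMdef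
  have hM0 : 0 < M := Real.sqrt_pos.2 (by positivity)
  have hM2 : M ^ 2 = 6 * 4 ^ n := Real.sq_sqrt (by positivity)
  have h4 : (1 : ℝ) ≤ 4 ^ n := one_le_pow₀ (by norm_num)
  have hM3 : 3 / M ^ 2 ≤ 1 := by
    rw [hM2, div_le_one (by positivity)]
    linarith
  set S : Set ℝ := {C | 0 ≤ C ∧ IsHilbertSchmidtBound T C} with hS
  obtain ⟨C₀, hC₀⟩ := exists_isHilbertSchmidtBound T
  have hne : S.Nonempty := ⟨C₀, hC₀⟩
  have hbdd : BddBelow S := ⟨0, fun C hC => hC.1⟩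
  set c := sInf S
  have hc0 : 0 ≤ c := le_csInf hne fun C hC => hC.1
  -- The infimum is itself a bound, so the self-improvement applies to it and gives an inequality
  -- for `c` with `c / 2` on the right.
  have hc : IsHilbertSchmidtBound T c := fun ι _ x hx =>
    le_csInf hne fun C hC => hC.2 ι x hx
  have himp := hc.of_truncation hM0 hM3 hc0 hA
  have hle : c ≤ 2 ^ n * (A ^ 2 * (M ^ 2) ^ n + 2 ^ n * (c * (3 / M ^ 2))) :=
    csInf_le hbdd ⟨by positivity, himp⟩
  have hhalf : (2 : ℝ) ^ n * (2 ^ n * (c * (3 / M ^ 2))) = c / 2 := by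
    have : (4 : ℝ) ^ n = 2 ^ n * 2 ^ n := by rw [← mul_pow]; norm_num
    rw [hM2, this]
    field_simp
    ring
  rw [mul_add, hhalf, hM2] at hle
  intro ι _ x hx
  refine (hc ι x hx).trans ?_
  nlinarith

end FiniteSupNorm

/-! ### Transfer to `ℒ_∞` spaces. -/

section ScriptLInfty

variable {𝕜 : Type*} [RCLike 𝕜]

/-- The weak `ℓ₂` norm of a weakly `2`-summable sequence is finite. -/
lemma IsWeaklySummable.exists_sum_norm_sq_le {E : Type*} [NormedAddCommGroup E] [NormedSpace 𝕜 E]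
    {x : ℕ → E} (hx : IsWeaklySummable 𝕜 2 x) :
    ∃ W : ℝ, 0 ≤ W ∧ ∀ (m : ℕ) (φ : E →L[𝕜] 𝕜), ∑ k : Fin m, ‖φ (x k)‖ ^ 2 ≤ W * ‖φ‖ ^ 2 := by
  have hsum : ∀ φ : E →L[𝕜] 𝕜, Summable fun k => ‖φ (x k)‖ ^ 2 := fun φ => by
    have := (memℓp_gen_iff (p := 2) (by norm_num)).1 (hx φ)
    simpa using this
  -- Uniform boundedness is applied on the dual of `E` to the functionals `φ ↦ ∑ aₖ φ (x k)`, with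
  -- `a` in the unit ball of `ℓ₂^m` for any `m`.
  let J := {p : Σ m : ℕ, (Fin m → 𝕜) // ∑ k, ‖p.2 k‖ ^ 2 ≤ 1}
  let ψ : J → ((E →L[𝕜] 𝕜) →L[𝕜] 𝕜) := fun p =>
    ∑ k, p.1.2 k • ContinuousLinearMap.apply 𝕜 𝕜 (x k)
  have hψ : ∀ p φ, ψ p φ = ∑ k, p.1.2 k * φ (x k) := fun p φ => by
    simp [ψ]
  obtain ⟨B, hB⟩ := banach_steinhaus (g := ψ) fun φ => by
    refine ⟨√(∑' k, ‖φ (x k)‖ ^ 2), fun p => ?_⟩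
    rw [hψ]
    refine Real.le_sqrt_of_sq_le ?_
    have h1 : ‖∑ k, p.1.2 k * φ (x k)‖ ≤ ∑ k, ‖p.1.2 k‖ * ‖φ (x k)‖ :=
      (norm_sum_le _ _).trans (le_of_eq (by simp only [norm_mul]))
    refine (pow_le_pow_left₀ (norm_nonneg _) h1 2).trans ?_
    refine (Finset.sum_mul_sq_le_sq_mul_sq _ _ _).trans ?_
    refine (mul_le_of_le_one_left (by positivity) p.2).trans ?_
    rw [Fin.sum_univ_eq_sum_range (fun k => ‖φ (x k)‖ ^ 2)]
    exact (hsum φ).sum_le_tsum _ fun _ _ => by positivity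
  refine ⟨B ^ 2, by positivity, fun m φ => ?_⟩
  set s := ∑ k : Fin m, ‖φ (x k)‖ ^ 2 with hs
  have hs0 : 0 ≤ s := by positivity
  rcases hs0.eq_or_lt with h | hpos
  · rw [← h]; positivity
  set r : ℝ := √s
  have hr : 0 < r := Real.sqrt_pos.2 hpos
  have hr2 : r ^ 2 = s := Real.sq_sqrt hs0
  -- The equality case of Cauchy–Schwarz.
  let p : J := ⟨⟨m, fun k => ((r⁻¹ : ℝ) : 𝕜) * star (φ (x k))⟩, by
    simp only [norm_mul, norm_star, mul_pow, RCLike.norm_ofReal, sq_abs, inv_pow, hr2]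
    rw [← Finset.mul_sum, inv_mul_cancel₀ hpos.ne']⟩
  have hp : ψ p φ = ((r : ℝ) : 𝕜) := by
    rw [hψ]
    have : ∀ k : Fin m, p.1.2 k * φ (x k) = ((r⁻¹ * ‖φ (x k)‖ ^ 2 : ℝ) : 𝕜) := fun k => by
      simp only [p, mul_assoc, RCLike.star_def, RCLike.conj_mul]
      push_cast
      rfl
    change ∑ k : Fin m, p.1.2 k * φ (x k) = _
    simp only [this]
    rw [← RCLike.ofReal_sum, ← Finset.mul_sum, ← hs, ← hr2]
    congr 1
    field_simp
  have h1 : r ≤ B * ‖φ‖ := by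
    have := ((ψ p).le_opNorm φ).trans (mul_le_mul_of_nonneg_right (hB p) (norm_nonneg _))
    rwa [hp, RCLike.norm_ofReal, abs_of_pos hr] at this
  rw [← hr2, ← mul_pow]
  gcongr

/-- Factors the first `m` vectors through some `ℓ_∞^d`. The coordinates of `v` extend by Hahn–Banach
to functionals on `E` of norm at most `c = ‖v‖`, which bounds the weak norm of `y`. Only `c * ‖u‖`
is controlled independently of `m`. -/
lemma IsScriptLInftyWith.exists_equiv {E : Type*} [NormedAddCommGroup E] [NormedSpace 𝕜 E]
    {lam : ℝ} (hE : IsScriptLInftyWith 𝕜 lam E) {x : ℕ → E} {W : ℝ} (hW : 0 ≤ W)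
    (hx : ∀ (m : ℕ) (φ : E →L[𝕜] 𝕜), ∑ k : Fin m, ‖φ (x k)‖ ^ 2 ≤ W * ‖φ‖ ^ 2) (m : ℕ) :
    ∃ (d : ℕ) (u : (Fin d → 𝕜) →L[𝕜] E) (y : Fin m → Fin d → 𝕜) (c : ℝ), 0 ≤ c ∧
      (∀ k, u (y k) = x k) ∧ (∀ t, ∑ k, ‖y k t‖ ^ 2 ≤ W * c ^ 2) ∧ c * ‖u‖ ≤ lam := by
  obtain ⟨F, hF, hfin, v, hv⟩ := hE (Submodule.span 𝕜 (Set.range fun k : Fin m => x k))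
    (FiniteDimensional.span_of_finite 𝕜 (Set.finite_range _))
  have hmem : ∀ k : Fin m, x k ∈ F := fun k => hF (Submodule.subset_span ⟨k, rfl⟩)
  set v' : F →L[𝕜] (Fin (Module.finrank 𝕜 F) → 𝕜) := v.toContinuousLinearMap
  set w' : (Fin (Module.finrank 𝕜 F) → 𝕜) →L[𝕜] F := v.symm.toContinuousLinearMap
  refine ⟨_, F.subtypeL.comp w', fun k => v ⟨x k, hmem k⟩, ‖v'‖, norm_nonneg _, fun k => ?_,
    fun t => ?_, ?_⟩
  · simp [w']
  · obtain ⟨φ, hφ, hnorm⟩ := exists_extension_norm_eq F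
      ((ContinuousLinearMap.proj (R := 𝕜) (φ := fun _ => 𝕜) t).comp v')
    have hφx : ∀ k : Fin m, v ⟨x k, hmem k⟩ t = φ (x k) := fun k => (hφ ⟨x k, hmem k⟩).symm
    have hφn : ‖φ‖ ≤ ‖v'‖ := by
      rw [hnorm]
      refine ContinuousLinearMap.opNorm_le_bound _ (norm_nonneg _) fun z => ?_
      exact (norm_le_pi_norm (v' z) t).trans (v'.le_opNorm z)
    simp only [hφx]
    refine (hx m φ).trans ?_
    gcongr
  · have h1 : ‖F.subtypeL.comp w'‖ ≤ ‖w'‖ :=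
      ContinuousLinearMap.opNorm_le_bound _ (norm_nonneg _) fun z => w'.le_opNorm z
    exact (mul_le_mul_of_nonneg_left h1 (norm_nonneg _)).trans hv.le

/-- Continuous multilinear forms on `ℒ_∞` spaces are multiple `2`-summing. -/
theorem exists_sum_norm_sq_le_of_isScriptLInfty {n : ℕ} {E : Fin n → Type*}
    [∀ k, NormedAddCommGroup (E k)] [∀ k, NormedSpace 𝕜 (E k)]
    (hE : ∀ k, IsScriptLInfty 𝕜 (E k)) (T : ContinuousMultilinearMap 𝕜 E 𝕜)
    {x : ∀ l, ℕ → E l} (hx : ∀ l, IsWeaklySummable 𝕜 2 (x l)) :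
    ∃ C : ℝ, ∀ m : ℕ, ∑ j : Fin n → Fin m, ‖T fun l => x l (j l)‖ ^ 2 ≤ C := by
  choose W hW0 hW using fun l => (hx l).exists_sum_norm_sq_le
  choose lam hlam hlamE using hE
  set K : ℝ := 2 * (2 ^ n * (6 * 4 ^ n) ^ n)
  -- Free of `m`: the factors `c l` from the weak norms and `‖u l‖` from composing with `T` occur
  -- only as products, bounded by `lam l`.
  refine ⟨K * ‖T‖ ^ 2 * ∏ l, (W l * lam l ^ 2), fun m => ?_⟩
  choose d u y c hc0 huy hy hcu using fun l => (hlamE l).exists_equiv (hW0 l) (hW l) m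
  set S : ContinuousMultilinearMap 𝕜 (fun l => Fin (d l) → 𝕜) 𝕜 :=
    T.compContinuousLinearMap u
  have hS : IsHilbertSchmidtBound S.toMultilinearMap (K * (‖T‖ * ∏ l, ‖u l‖) ^ 2) := by
    refine isHilbertSchmidtBound_of_norm_le fun z => ?_
    exact (S.le_opNorm z).trans (mul_le_mul_of_nonneg_right
      (T.norm_compContinuousLinearMap_le u) (by positivity))
  have h := hS.sum_le_mul_prod (fun _ => Fin m) y (fun l => W l * c l ^ 2)
    (fun l => mul_nonneg (hW0 l) (sq_nonneg _)) hy
  calc _ = ∑ j : Fin n → Fin m, ‖S.toMultilinearMap fun l => y l (j l)‖ ^ 2 := by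
        refine Finset.sum_congr rfl fun j _ => ?_
        simp [S, huy]
    _ ≤ _ := h
    _ = K * ‖T‖ ^ 2 * ∏ l, (W l * (c l * ‖u l‖) ^ 2) := by
        rw [mul_pow, ← Finset.prod_pow, ← mul_assoc, mul_assoc (_ * _), ← Finset.prod_mul_distrib]
        congr 1
        refine Finset.prod_congr rfl fun l _ => ?_
        ring
    _ ≤ _ := by
        have hK : 0 ≤ K := by positivity
        gcongr with l
        · exact fun l _ => mul_nonneg (hW0 l) (sq_nonneg _)
        · exact hW0 l
        · exact mul_nonneg (hc0 l) (norm_nonneg _)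
        · exact hcu l

end ScriptLInfty

theorem mainTheorem10 {𝕜 : Type*} [RCLike 𝕜] (n : ℕ) (hn : 2 ≤ n) (E : Fin n → Type*)
    [∀ k, NormedAddCommGroup (E k)] [∀ k, NormedSpace 𝕜 (E k)] [∀ k, CompleteSpace (E k)]
    (hE : ∀ k, IsScriptLInfty 𝕜 (E k))
    (T : ContinuousMultilinearMap 𝕜 E 𝕜) :
    IsFullySumming 2 2 (fun _ => 2) T := by
  classical
  intro x hx
  obtain ⟨C, hC⟩ := exists_sum_norm_sq_le_of_isScriptLInfty hE T hx
  simp only [Real.rpow_two]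
  refine summable_of_sum_le (c := C) (fun _ => by positivity) fun s => ?_
  obtain ⟨m, hm⟩ : ∃ m : ℕ, ∀ j ∈ s, ∀ i, j i < m := by
    refine ⟨(s.sup fun j => Finset.univ.sup j) + 1, fun j hj i => Nat.lt_succ_of_le ?_⟩
    exact (Finset.le_sup (f := j) (Finset.mem_univ i)).trans
      (Finset.le_sup (f := fun j : Fin 2 → ℕ => Finset.univ.sup j) hj)
  -- Slot `l` uses index number `σ l`. Both indices occur because `2 ≤ n`, so `j ↦ j ∘ σ` is
  -- injective and embeds the double sum in the `n`-fold one.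
  let σ : Fin n → Fin 2 := fun l => ⟨min (l : ℕ) (2 - 1), by omega⟩
  have hσ : Function.Surjective σ := fun i =>
    ⟨⟨i, by omega⟩, Fin.ext (by simp only [σ]; omega)⟩
  let e : s → Fin n → Fin m := fun j l => ⟨j.1 (σ l), hm j.1 j.2 _⟩
  have he : Function.Injective e := fun j j' h => by
    refine Subtype.ext (funext fun i => ?_)
    obtain ⟨l, rfl⟩ := hσ i
    exact congrArg Fin.val (congrFun h l)
  calc _ = ∑ j : s, ‖T fun l => x l (e j l)‖ ^ 2 := (Finset.sum_coe_sort s _).symm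
    _ = ∑ j ∈ Finset.univ.image e, ‖T fun l => x l (j l)‖ ^ 2 :=
        (Finset.sum_image (f := fun j : Fin n → Fin m => ‖T fun l => x l (j l)‖ ^ 2)
          he.injOn).symm
    _ ≤ ∑ j : Fin n → Fin m, ‖T fun l => x l (j l)‖ ^ 2 :=
        Finset.sum_le_univ_sum_of_nonneg fun _ => by positivity
    _ ≤ C := hC m
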